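/- Let $A$ be an alphabet, and let $\Xi$ be a set of three unknowns. A (coefficient-free) word equation $E: u=v$ on $\Xi$ consists of two words $u,v\in\Xi^*$; it is trivial if $u$ and $v$ are the same word. A solution of $E$ is a morphism $h:\Xi^*\to A^*$ with $h(u)=h(v)$, and a solution of a system is a common solution of all its equations; $\mathrm{Sol}(\cdot)$ denotes the set of all solutions. For $x\in\Xi$ let $|E|_x$ be the number of occurrences of $x$ in the word $uv$. The rank of a morphism $h:\Xi^*\to A^*$ is the least number $r$ for which there is a set $S\subseteq A^*$ of $r$ words with $h(x)\in S^*$ for every unknown $x$; $h$ is periodic if its rank is at most $1$. A system $E_1,\dots,E_m$ is independent if it is not equivalent to (does not have the same solutions as) any of its proper subsystems. A sequence $E_1,\dots,E_m$ of nontrivial equations is a chain if $$\mathrm{Sol}(E_1)\supsetneq \mathrm{Sol}(E_1,E_2)\supsetneq\dots\supsetneq\mathrm{Sol}(E_1,\dots,E_m).$$ Let $m\ge 1$ and let $E_1,\dots,E_m$ be word equations on the three unknowns $\Xi$. 1. If $E_1,\dots,E_m$ is an independent system that has a nonperiodic solution, then there are two distinct unknowns $x,y\in\Xi$ such that $m\le(|E_1|_x+|E_1|_y)^2+1$.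 2. If $E_1,\dots,E_m$ is a chain, then there are two distinct unknowns $x,y\in\Xi$ such that $m\le(|E_1|_x+|E_1|_y)^2+5$. -/

import Mathlib

namespace WordEq

/-- A (coefficient-free) word equation `lhs = rhs` with unknowns in `X`. -/
structure Equation (X : Type*) where
  lhs : FreeMonoid X
  rhs : FreeMonoid X

/-- The equation is trivial if its two sides are the same word. -/
def Equation.IsTrivial {X : Type*} (E : Equation X) : Prop :=
  E.lhs = E.rhs

/-- The number of occurrences of the unknown `x` in the equation, on both sides together. -/
def Equation.occ {X : Type*} [DecidableEq X] (E : Equation X) (x : X) : ℕ :=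
  (E.lhs * E.rhs).toList.count x

/-- The solutions of an equation over the alphabet `A`. -/
def Equation.sol {X : Type*} (A : Type*) (E : Equation X) :
    Set (FreeMonoid X →* FreeMonoid A) :=
  {h | h E.lhs = h E.rhs}

/-- The common solutions over `A` of the equations `E i` with `i ∈ I`
(all morphisms, if `I` is empty). -/
def sysSol {X ι : Type*} (A : Type*) (E : ι → Equation X) (I : Set ι) :
    Set (FreeMonoid X →* FreeMonoid A) :=
  {h | ∀ i ∈ I, h ∈ (E i).sol A}

/-- The combinatorial rank of a morphism: the least size of a set `S` of words such that
the image of every unknown is a product of words of `S`. -/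
noncomputable def rank {X A : Type*} (h : FreeMonoid X →* FreeMonoid A) : ℕ∞ :=
  ⨅ (S : Set (FreeMonoid A)) (_ : ∀ x : X, h (FreeMonoid.of x) ∈ Submonoid.closure S), S.encard

/-- A morphism is periodic if its rank is at most one. -/
def IsPeriodic {X A : Type*} (h : FreeMonoid X →* FreeMonoid A) : Prop :=
  rank h ≤ 1

/-- The system is not equivalent (over the alphabet `A`) to any of its proper subsystems. -/
def IsIndependent {X ι : Type*} (A : Type*) (E : ι → Equation X) : Prop :=
  ∀ I : Set ι, I ⊂ Set.univ → sysSol A E I ≠ sysSol A E Set.univ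

/-- All equations are nontrivial, and the solution sets (over the alphabet `A`) of the initial
subsystems form a strictly decreasing sequence. -/
def IsChain {X : Type*} (A : Type*) {m : ℕ} (E : Fin m → Equation X) : Prop :=
  (∀ i, ¬ (E i).IsTrivial) ∧ StrictAnti (fun i : Fin m => sysSol A E (Set.Iic i))

end WordEq

/-!
Let `h` be a nonperiodic solution of a nontrivial equation in three unknowns. By the defect
theorem, `h` has the same kernel as some `g : {0, 1, 2}* → {0, 1}*`; obtaining `g` by successively
erasing an unknown or applying an elementary morphism shows that its Parikh matrix has rank two,
so that the kernel of that matrix is a line.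

By the chain rule for Fox derivatives, `g` solves `E` exactly when the vector `D E` of differences
of Fox derivatives of the two sides becomes, under the specialization of monomials induced by `g`,
orthogonal to both rows of the Fox Jacobian of `g`. These rows are independent, so if `g` solves a
nontrivial `E`, it solves `F` exactly when the specialization kills `D E × D F`. Whether this
happens depends only on the kernel of the Parikh matrix of `g`. Hence among the solutions of `E`
that line determines the kernel congruence of `g`.

If some solution of `E` is not a solution of `F`, a coordinate of `D E × D F` is nonzero. It is a
signed sum of monomials, which form `n = |E|_x + |E|_y` increasing chains of either sign because
the prefixes of a word do. A specialization killing it must identify a positive and a negative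
monomial, and it is enough to test one monomial of each chain. So each of the lines in question
contains one of `n ^ 2` given vectors, and the nonperiodic common solutions of `E` and `F` have at
most `n ^ 2` kernels.

Choose a solution witnessing the role of each equation. Distinct equations have witnesses with
distinct kernels, and all but boundedly many witnesses solve both `E₁` and one further equation.
A periodic solution is tested by a linear form in the lengths of the images of the unknowns. In a
chain, these forms bound the number of periodic witnesses by three; in an independent system with
a nonperiodic solution, all of them vanish, so that no witness is periodic.
-/

namespace WordEq

section CrossProduct

open Matrix

variable {R S : Type*} [CommRing R] [CommRing S]

lemma cross_eq_zero_iff {v w : Fin 3 → R} : v ⨯₃ w = 0 ↔ ∀ i j, v i * w j = v j * w i := by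
  rw [cross_apply]
  constructor
  · intro h
    have h0 := congrFun h 0
    have h1 := congrFun h 1
    have h2 := congrFun h 2
    simp only [cons_val_zero, cons_val_one, cons_val, Pi.zero_apply, sub_eq_zero] at h0 h1 h2
    intro i j
    fin_cases i <;> fin_cases j <;>
      simp only [Fin.zero_eta, Fin.mk_one, Fin.reduceFinMk, h0, h1, h2]
  · intro h
    rw [h 1 2, h 2 0, h 0 1, sub_self, sub_self, sub_self]
    simp

lemma map_comp_cross (f : R →+* S) (v w : Fin 3 → R) : f ∘ (v ⨯₃ w) = (f ∘ v) ⨯₃ (f ∘ w) := by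
  ext i
  fin_cases i <;> simp [cross_apply]

lemma cross_ne_zero_of_mulVec_surjective [Nontrivial R] {M : Matrix (Fin 2) (Fin 3) R}
    (hM : Function.Surjective M.mulVec) : M 0 ⨯₃ M 1 ≠ 0 := by
  obtain ⟨d, hd⟩ := hM ![1, 0]
  obtain ⟨e, he⟩ := hM ![0, 1]
  intro h
  have hdet := cross_dot_cross (M 0) (M 1) d e
  rw [h, zero_dotProduct] at hdet
  have entry (v : Fin 3 → R) (c : Fin 2) : M c ⬝ᵥ v = (M *ᵥ v) c := rfl
  simp [entry, hd, he] at hdet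

variable [IsDomain R]

lemma dotProduct_eq_zero_of_cross_eq_zero {q q' p : Fin 3 → R} (hq : q ≠ 0) (hqq' : q ⨯₃ q' = 0)
    (h : q ⬝ᵥ p = 0) : q' ⬝ᵥ p = 0 := by
  obtain ⟨k, hk⟩ := Function.ne_iff.1 hq
  have hsmul : q k • q' = q' k • q := by
    ext i
    simpa [mul_comm] using cross_eq_zero_iff.1 hqq' k i
  have : q k * (q' ⬝ᵥ p) = 0 := by
    rw [← smul_eq_mul, ← smul_dotProduct, hsmul, smul_dotProduct, h, smul_zero]
  exact (mul_eq_zero.1 this).resolve_left hk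

lemma cross_eq_zero_trans {u v w : Fin 3 → R} (hv : v ≠ 0) (huv : u ⨯₃ v = 0)
    (hvw : v ⨯₃ w = 0) : u ⨯₃ w = 0 := by
  obtain ⟨k, hk⟩ := Function.ne_iff.1 hv
  rw [cross_eq_zero_iff] at *
  intro i j
  apply mul_left_cancel₀ hk
  apply mul_left_cancel₀ hk
  linear_combination (v k * w j) * huv i k + u k * v i * hvw k j -
    (v k * w i) * huv j k - u k * v j * hvw k i

lemma cross_eq_zero_of_dotProduct_eq_zero {p p' q q' : Fin 3 → R} (hp : p ⨯₃ p' ≠ 0)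
    (h₁ : q ⬝ᵥ p = 0) (h₂ : q ⬝ᵥ p' = 0) (h₃ : q' ⬝ᵥ p = 0) (h₄ : q' ⬝ᵥ p' = 0) :
    q ⨯₃ q' = 0 := by
  have perp_parallel {r : Fin 3 → R} (hr : r ⬝ᵥ p = 0) (hr' : r ⬝ᵥ p' = 0) :
      r ⨯₃ (p ⨯₃ p') = 0 := by
    rw [cross_cross_eq_smul_sub_smul', dotProduct_comm p, hr, hr', zero_smul, zero_smul, sub_zero]
  have h := perp_parallel h₃ h₄
  rw [← neg_eq_zero, cross_anticomm] at h
  exact cross_eq_zero_trans hp (perp_parallel h₁ h₂) h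

lemma mulVec_eq_zero_of_common_kernel {κ : Type*} {M : Matrix (Fin 2) (Fin 3) R}
    (hM : M 0 ⨯₃ M 1 ≠ 0) {M' : Matrix κ (Fin 3) R} {d e : Fin 3 → R} (hd : d ≠ 0)
    (hMd : M *ᵥ d = 0) (hMd' : M' *ᵥ d = 0) (hMe : M *ᵥ e = 0) : M' *ᵥ e = 0 := by
  have hde : d ⨯₃ e = 0 := by
    refine cross_eq_zero_of_dotProduct_eq_zero hM ?_ ?_ ?_ ?_ <;> rw [dotProduct_comm]
    exacts [congrFun hMd 0, congrFun hMd 1, congrFun hMe 0, congrFun hMe 1]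
  ext c
  exact (dotProduct_comm _ _).trans
    (dotProduct_eq_zero_of_cross_eq_zero hd hde ((dotProduct_comm _ _).trans (congrFun hMd' c)))

end CrossProduct

section Parikh

open FreeMonoid
open scoped Matrix

variable {X Y Z : Type*} [DecidableEq X] [DecidableEq Y] [DecidableEq Z]

/-- The Parikh vector of a word: its numbers of occurrences of each letter, as elements of `R`
(the additive structure is needed over `ℕ`, the linear one over `ℤ`). -/
def parikh (R : Type*) [NatCast R] (u : FreeMonoid X) (x : X) : R :=
  u.toList.count x

/-- The Parikh matrix of a morphism: its columns are the Parikh vectors of the images of the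
letters. -/
def parikhMatrix (R : Type*) [NatCast R] (g : FreeMonoid X →* FreeMonoid Y) : Matrix Y X R :=
  Matrix.of fun c x => parikh R (g (of x)) c

variable {R : Type*} [Semiring R]

@[simp] lemma parikh_one : parikh R (1 : FreeMonoid X) = 0 := by
  ext x
  simp [parikh]

@[simp] lemma parikh_of (x : X) : parikh R (of x) = Pi.single x 1 := by
  ext y
  by_cases h : y = x <;> simp [parikh, h, Ne.symm]

@[simp] lemma parikh_mul (u v : FreeMonoid X) : parikh R (u * v) = parikh R u + parikh R v := by
  ext x
  simp [parikh]

lemma parikh_map [Fintype X] (g : FreeMonoid X →* FreeMonoid Y) (u : FreeMonoid X) :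
    parikh R (g u) = parikhMatrix R g *ᵥ parikh R u := by
  induction u using FreeMonoid.inductionOn' with
  | one => simp
  | of_mul x u ih =>
    rw [map_mul, parikh_mul, parikh_mul, Matrix.mulVec_add, ih, parikh_of, Matrix.mulVec_single_one]
    rfl

lemma parikhMatrix_id : parikhMatrix R (MonoidHom.id (FreeMonoid X)) = 1 := by
  ext c x
  simp [parikhMatrix, Matrix.one_apply, Pi.single_apply]

omit [DecidableEq X] in
lemma parikhMatrix_comp [Fintype Y] (f : FreeMonoid Y →* FreeMonoid Z)
    (g : FreeMonoid X →* FreeMonoid Y) :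
    parikhMatrix R (f.comp g) = parikhMatrix R f * parikhMatrix R g := by
  ext c x
  exact congrFun (parikh_map f (g (of x))) c

end Parikh

section Elementary

open FreeMonoid
open scoped Matrix

variable {X A : Type*}

lemma lift_mul_of_injective (p : X → FreeMonoid X) :
    Function.Injective (lift fun x => p x * of x) := by
  have lift_append (u : List X) (x : X) : lift (fun x => p x * of x) (ofList (u ++ [x])) =
      lift (fun x => p x * of x) (ofList u) * p x * of x := by
    rw [ofList_append, map_mul, ofList_singleton, lift_eval_of, mul_assoc]
  have mul_of_ne_one (w : FreeMonoid X) (x : X) : w * of x ≠ 1 := fun h => by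
    simpa using congrArg length h
  intro (u : List X)
  induction u using List.reverseRecOn with
  | nil =>
    intro (v : List X) h
    rcases v.eq_nil_or_concat' with rfl | ⟨v, y, rfl⟩
    · rfl
    · exact absurd (h.symm.trans (map_one _)) (lift_append v y ▸ mul_of_ne_one _ _)
  | append_singleton u x ih =>
    intro (v : List X) h
    rcases v.eq_nil_or_concat' with rfl | ⟨v, y, rfl⟩
    · exact absurd (h.trans (map_one _)) (lift_append u x ▸ mul_of_ne_one _ _)
    · obtain ⟨huv, rfl⟩ := List.append_singleton_inj.1
        ((lift_append u x).symm.trans (h.trans (lift_append v y)))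
      exact congrArg (· ++ [x]) (ih (mul_right_cancel (b := p x) huv))

variable [DecidableEq X]

/-- The elementary endomorphism `a ↦ b a`, fixing all letters other than `a`. -/
def elementary (a b : X) : FreeMonoid X →* FreeMonoid X :=
  lift fun x => Function.update (1 : X → FreeMonoid X) a (of b) x * of x

lemma elementary_injective (a b : X) : Function.Injective (elementary a b) :=
  lift_mul_of_injective _

lemma parikhMatrix_elementary {R : Type*} [CommRing R] {a b : X} :
    parikhMatrix R (elementary a b) = Matrix.transvection b a 1 := by
  ext c x
  rcases eq_or_ne x a with rfl | hx
  · simp [parikhMatrix, elementary, Matrix.transvection, Matrix.one_apply, Matrix.single_apply,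
      Pi.single_apply, add_comm, eq_comm]
  · simp [parikhMatrix, elementary, Matrix.transvection, Matrix.one_apply, Pi.single_apply, hx,
      hx.symm]

lemma parikhMatrix_elementary_surjective {R : Type*} [CommRing R] [Fintype X] {a b : X}
    (hab : a ≠ b) : Function.Surjective (parikhMatrix R (elementary a b)).mulVec := by
  rw [Matrix.mulVec_surjective_iff_isUnit, Matrix.isUnit_iff_isUnit_det, parikhMatrix_elementary,
    Matrix.det_transvection_of_ne _ _ hab.symm]
  exact isUnit_one

lemma lift_update_comp_elementary {h : FreeMonoid X →* FreeMonoid A} {a b : X} {w : FreeMonoid A}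
    (hab : a ≠ b) (hw : h (of a) = h (of b) * w) :
    (lift (Function.update (h ∘ of) a w)).comp (elementary a b) = h := by
  refine hom_eq fun x => ?_
  rcases eq_or_ne x a with rfl | hx
  · simp [elementary, hab.symm, hw]
  · simp [elementary, hx]

lemma sum_length_update_lt [Fintype X] {h : X → FreeMonoid A} {a b : X} {w : FreeMonoid A}
    (hb : h b ≠ 1) (hw : h a = h b * w) :
    ∑ x, (Function.update h a w x).length < ∑ x, (h x).length := by
  have hlt : w.length < (h a).length := by
    rw [hw, length_mul]
    have : (h b).length ≠ 0 := length_eq_zero.not.2 hb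
    lia
  refine Finset.sum_lt_sum (fun x _ => ?_) ⟨a, Finset.mem_univ a, by simpa using hlt⟩
  rcases eq_or_ne x a with rfl | hx
  · simpa using hlt.le
  · simp [hx]

end Elementary

section Defect

open FreeMonoid
open scoped Matrix

variable {X A : Type*}

lemma exists_eq_mul_or_of_mul_eq_mul {a b c d : FreeMonoid A} (h : a * c = b * d) :
    (∃ e, a = b * e) ∨ ∃ e, b = a * e := by
  rcases List.append_eq_append_iff.1 (congrArg toList h) with ⟨e, hb, -⟩ | ⟨e, ha, -⟩
  · exact Or.inr ⟨e, hb⟩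
  · exact Or.inl ⟨e, ha⟩

lemma exists_eq_mul_of_not_injective {h : FreeMonoid X →* FreeMonoid A}
    (hne : ∀ x, h (of x) ≠ 1) (hinj : ¬ Function.Injective h) :
    ∃ a b w, a ≠ b ∧ h (of a) = h (of b) * w := by
  contrapose! hinj
  have map_of_mul_ne_one (x : X) (t : FreeMonoid X) : h (of x * t) ≠ 1 := by
    simp [hne x]
  intro u
  induction u using FreeMonoid.inductionOn' with
  | one =>
    intro v huv
    cases v using FreeMonoid.casesOn with
    | one => rfl
    | of_mul y v => exact absurd (huv.symm.trans (map_one h)) (map_of_mul_ne_one y v)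
  | of_mul x u ih =>
    intro v huv
    cases v using FreeMonoid.casesOn with
    | one => exact absurd (huv.trans (map_one h)) (map_of_mul_ne_one x u)
    | of_mul y v =>
      rw [map_mul, map_mul] at huv
      rcases eq_or_ne x y with rfl | hxy
      · rw [ih (mul_left_cancel huv)]
      · rcases exists_eq_mul_or_of_mul_eq_mul huv with ⟨w, hw⟩ | ⟨w, hw⟩
        · exact absurd hw (hinj x y w hxy)
        · exact absurd hw (hinj y x w hxy.symm)

/-- The morphism deleting the letter `p` and renumbering the others. -/
def erase {n : ℕ} (p : Fin (n + 1)) : FreeMonoid (Fin (n + 1)) →* FreeMonoid (Fin n) :=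
  lift (p.insertNth 1 of)

lemma erase_comp_map_succAbove {n : ℕ} (p : Fin (n + 1)) :
    (erase p).comp (FreeMonoid.map p.succAbove) = MonoidHom.id _ :=
  hom_eq fun x => by simp [erase]

lemma comp_map_succAbove_comp_erase {n : ℕ} {h : FreeMonoid (Fin (n + 1)) →* FreeMonoid A}
    {p : Fin (n + 1)} (hp : h (of p) = 1) :
    (h.comp (FreeMonoid.map p.succAbove)).comp (erase p) = h := by
  refine hom_eq fun x => ?_
  induction x using p.succAboveCases with
  | x => simp [erase, hp]
  | p i => simp [erase]

lemma parikhMatrix_erase_surjective {R : Type*} [Semiring R] {n : ℕ} (p : Fin (n + 1)) :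
    Function.Surjective (parikhMatrix R (erase p)).mulVec := fun v =>
  ⟨parikhMatrix R (FreeMonoid.map p.succAbove) *ᵥ v, by
    rw [Matrix.mulVec_mulVec, ← parikhMatrix_comp, erase_comp_map_succAbove, parikhMatrix_id,
      Matrix.one_mulVec]⟩

lemma parikhMatrix_comp_surjective {R X Y Z : Type*} [Semiring R] [DecidableEq Y] [DecidableEq Z]
    [Fintype X] [Fintype Y] {f : FreeMonoid Y →* FreeMonoid Z} {g : FreeMonoid X →* FreeMonoid Y}
    (hf : Function.Surjective (parikhMatrix R f).mulVec)
    (hg : Function.Surjective (parikhMatrix R g).mulVec) :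
    Function.Surjective (parikhMatrix R (f.comp g)).mulVec := by
  intro v
  obtain ⟨w, rfl⟩ := hf v
  obtain ⟨u, rfl⟩ := hg w
  exact ⟨u, by rw [parikhMatrix_comp, Matrix.mulVec_mulVec]⟩

theorem exists_injective_comp_eq {n : ℕ} (h : FreeMonoid (Fin n) →* FreeMonoid A) :
    ∃ k ≤ n, ∃ (g : FreeMonoid (Fin n) →* FreeMonoid (Fin k))
      (θ : FreeMonoid (Fin k) →* FreeMonoid A), Function.Injective θ ∧ θ.comp g = h ∧
        Function.Surjective (parikhMatrix ℤ g).mulVec ∧ (k = n → Function.Injective h) := by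
  induction hsize : n + ∑ x, (h (of x)).length using Nat.strong_induction_on generalizing n with
  | _ size ih =>
  by_cases hinj : Function.Injective h
  · exact ⟨n, le_rfl, .id _, h, hinj, h.comp_id,
      fun v => ⟨v, by rw [parikhMatrix_id, Matrix.one_mulVec]⟩, fun _ => hinj⟩
  by_cases hne : ∀ x, h (of x) ≠ 1
  · obtain ⟨a, b, w, hab, hw⟩ := exists_eq_mul_of_not_injective hne hinj
    have hdecr := sum_length_update_lt (h := h ∘ of) (hne b) hw
    obtain ⟨k, hk, g, θ, hθ, hcomp, hsurj, hkn⟩ :=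
      ih _ (by simpa [← hsize] using hdecr) (lift (Function.update (h ∘ of) a w)) rfl
    have hh := lift_update_comp_elementary hab hw
    refine ⟨k, hk, g.comp (elementary a b), θ, hθ, ?_,
      parikhMatrix_comp_surjective hsurj (parikhMatrix_elementary_surjective hab), fun hkn' => ?_⟩
    · rw [← MonoidHom.comp_assoc, hcomp, hh]
    · rw [← hh]
      exact (hkn hkn').comp (elementary_injective a b)
  · obtain ⟨p, hp⟩ := not_forall_not.1 hne
    obtain _ | n := n
    · exact p.elim0
    obtain ⟨k, hk, g, θ, hθ, hcomp, hsurj, -⟩ :=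
      ih _ (by simp [← hsize, Fin.sum_univ_succAbove _ p]; lia)
        (h.comp (FreeMonoid.map p.succAbove)) rfl
    refine ⟨k, by lia, g.comp (erase p), θ, hθ, ?_,
      parikhMatrix_comp_surjective hsurj (parikhMatrix_erase_surjective p), by lia⟩
    rw [← MonoidHom.comp_assoc, hcomp, comp_map_succAbove_comp_erase hp]

lemma rank_comp_le {Y : Type*} (θ : FreeMonoid Y →* FreeMonoid A)
    (g : FreeMonoid X →* FreeMonoid Y) : rank (θ.comp g) ≤ ENat.card Y := by
  have hmem (x : X) : θ.comp g (of x) ∈ Submonoid.closure (Set.range (θ ∘ of)) := by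
    rw [Set.range_comp, ← MonoidHom.map_mclosure, closure_range_of]
    exact ⟨g (of x), trivial, rfl⟩
  refine (iInf₂_le _ hmem).trans ?_
  rw [← Set.image_univ, ← Set.encard_univ]
  exact Set.encard_image_le _ _

theorem exists_ker_eq_of_not_isPeriodic {h : FreeMonoid (Fin 3) →* FreeMonoid A}
    (hper : ¬ IsPeriodic h) (hinj : ¬ Function.Injective h) :
    ∃ g : FreeMonoid (Fin 3) →* FreeMonoid (Fin 2), Con.ker g = Con.ker h ∧
      Function.Surjective (parikhMatrix ℤ g).mulVec := by
  obtain ⟨k, hk, g, θ, hθ, rfl, hsurj, hk3⟩ := exists_injective_comp_eq h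
  have hk1 : 1 < k := by
    have := (not_le.1 hper).trans_le (rank_comp_le θ g)
    simpa using this
  obtain rfl : k = 2 := by
    have : k ≠ 3 := fun h => hinj (hk3 h)
    lia
  exact ⟨g, Con.ext fun u v => hθ.eq_iff.symm, hsurj⟩

end Defect

section MonomialSum

open AddMonoidAlgebra

variable {M N : Type*}

/-- The element `∑ X^m` of the integral monoid algebra, with `m` running over a list of exponents.
Fox derivatives are of this form, and the list is what the counting argument needs. -/
noncomputable def monomialSum (l : List M) : AddMonoidAlgebra ℤ M :=
  (l.map fun m => single m 1).sum

@[simp] lemma monomialSum_nil : monomialSum ([] : List M) = 0 := rfl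

@[simp] lemma monomialSum_cons (m : M) (l : List M) :
    monomialSum (m :: l) = single m 1 + monomialSum l := by
  simp [monomialSum]

@[simp] lemma monomialSum_append (l l' : List M) :
    monomialSum (l ++ l') = monomialSum l + monomialSum l' := by
  simp [monomialSum]

lemma coeff_monomialSum [DecidableEq M] (l : List M) (m : M) :
    (monomialSum l).coeff m = l.count m := by
  induction l with
  | nil => simp
  | cons a l ih =>
    simp [ih, List.count_cons, Finsupp.single_apply, add_comm]

lemma monomialSum_inj {l l' : List M} : monomialSum l = monomialSum l' ↔ l.Perm l' := by
  classical
  rw [List.perm_iff_count]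
  refine ⟨fun h m => ?_, fun h => ?_⟩
  · have := congrArg (fun f => f.coeff m) h
    simpa [coeff_monomialSum] using this
  · ext m
    simp [coeff_monomialSum, h m]

lemma mapDomain_monomialSum (G : M → N) (l : List M) :
    mapDomain G (monomialSum l) = monomialSum (l.map G) := by
  induction l with
  | nil => simp
  | cons a l ih => simp [mapDomain_add, ih]

lemma monomialSum_map_add [AddMonoid M] (m : M) (l : List M) :
    monomialSum (l.map (m + ·)) = single m 1 * monomialSum l := by
  induction l with
  | nil => simp
  | cons a l ih => simp [ih, mul_add]

end MonomialSum

section Fox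

open AddMonoidAlgebra FreeMonoid
open scoped Matrix

variable {X Y : Type*} [DecidableEq X] [DecidableEq Y]

/-- The Parikh vectors of the prefixes of a word that precede an occurrence of the letter `x`. -/
def prefixParikh (x : X) : List X → List (X → ℕ)
  | [] => []
  | a :: u => (if a = x then [0] else []) ++ (prefixParikh x u).map (Pi.single a 1 + ·)

lemma length_prefixParikh (x : X) (u : List X) : (prefixParikh x u).length = u.count x := by
  induction u with
  | nil => rfl
  | cons a u ih =>
    simp only [prefixParikh, List.length_append, List.length_map, ih, List.count_cons, beq_iff_eq]
    split_ifs <;> simp [add_comm]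

lemma pairwise_prefixParikh (x : X) (u : List X) : (prefixParikh x u).Pairwise (· ≤ ·) := by
  induction u with
  | nil => simp [prefixParikh]
  | cons a u ih =>
    have hmap : ((prefixParikh x u).map (Pi.single a 1 + ·)).Pairwise (· ≤ ·) :=
      ih.map _ fun p q hpq => add_le_add_right hpq _
    rw [prefixParikh]
    split_ifs
    · exact List.pairwise_cons.2 ⟨fun _ _ => zero_le, hmap⟩
    · exact hmap

/-- The abelianized Fox derivative of a word with respect to the letter `x`: the sum of the
monomials attached to the prefixes preceding the occurrences of `x`. -/
noncomputable def fox (x : X) (u : FreeMonoid X) : AddMonoidAlgebra ℤ (X → ℕ) :=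
  monomialSum (prefixParikh x u.toList)

@[simp] lemma fox_one (x : X) : fox x 1 = 0 := rfl

lemma fox_of_mul (x a : X) (u : FreeMonoid X) :
    fox x (of a * u) = (if a = x then 1 else 0) + single (Pi.single a 1) 1 * fox x u := by
  rw [fox, toList_of_mul, prefixParikh, monomialSum_append, monomialSum_map_add]
  split_ifs <;> simp [fox, one_def]

lemma fox_mul (x : X) (u v : FreeMonoid X) :
    fox x (u * v) = fox x u + single (parikh ℕ u) 1 * fox x v := by
  induction u using FreeMonoid.inductionOn' with
  | one => simp [← one_def]
  | of_mul a u ih =>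
    have : (single (Pi.single a 1 + parikh ℕ u) 1 : AddMonoidAlgebra ℤ (X → ℕ)) =
        single (Pi.single a 1) 1 * single (parikh ℕ u) 1 := by simp
    rw [mul_assoc, fox_of_mul, ih, fox_of_mul, parikh_mul, parikh_of, this]
    ring

lemma lift_fox (x : X) (u : FreeMonoid X) :
    AddMonoidAlgebra.lift ℤ ℤ (X → ℕ) 1 (fox x u) = parikh ℤ u x := by
  induction u using FreeMonoid.inductionOn' with
  | one => simp
  | of_mul a u ih =>
    rw [fox_of_mul, map_add, map_mul, ih, parikh_mul, parikh_of, Pi.add_apply]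
    by_cases h : a = x <;> simp [h, Ne.symm]

/-- The action of a morphism on Parikh vectors. -/
def parikhHom [Fintype X] (g : FreeMonoid X →* FreeMonoid Y) : (X → ℕ) →+ (Y → ℕ) :=
  (parikhMatrix ℕ g).mulVecLin.toAddMonoidHom

lemma parikhHom_single [Fintype X] (g : FreeMonoid X →* FreeMonoid Y) (x : X) :
    parikhHom g (Pi.single x 1) = parikh ℕ (g (of x)) := by
  rw [← parikh_of, parikh_map]
  rfl

omit [DecidableEq X] in
lemma parikhHom_eq_parikhHom_iff [Fintype X] (g : FreeMonoid X →* FreeMonoid Y) (u v : X → ℕ) :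
    parikhHom g u = parikhHom g v ↔
      parikhMatrix ℤ g *ᵥ (fun x => (u x : ℤ) - v x) = 0 := by
  have cast_parikhHom (w : X → ℕ) (c : Y) :
      (parikhHom g w c : ℤ) = (parikhMatrix ℤ g *ᵥ fun x => (w x : ℤ)) c := by
    simp [parikhHom, parikhMatrix, Matrix.mulVec, dotProduct, parikh]
  rw [← Pi.sub_def, Matrix.mulVec_sub, sub_eq_zero, funext_iff, funext_iff]
  simp only [← cast_parikhHom, Nat.cast_inj]

theorem fox_map [Fintype X] (c : Y) (g : FreeMonoid X →* FreeMonoid Y) (u : FreeMonoid X) :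
    fox c (g u) = ∑ x, mapDomainRingHom ℤ (parikhHom g) (fox x u) * fox c (g (of x)) := by
  induction u using FreeMonoid.inductionOn' with
  | one => simp
  | of_mul a u ih =>
    have map_fox (x : X) : mapDomainRingHom ℤ (parikhHom g) (fox x (of a * u)) =
        (if a = x then 1 else 0) + single (parikh ℕ (g (of a))) 1 *
          mapDomainRingHom ℤ (parikhHom g) (fox x u) := by
      rw [fox_of_mul, map_add, map_mul, apply_ite (mapDomainRingHom ℤ (parikhHom g)), map_one,
        map_zero, mapDomainRingHom_apply, mapDomain_single, parikhHom_single]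
    rw [map_mul, fox_mul, ih]
    simp only [map_fox, add_mul, ite_mul, one_mul, zero_mul,
      Finset.sum_add_distrib, Finset.sum_ite_eq, Finset.mem_univ, if_true, Finset.mul_sum,
      mul_assoc]

lemma map_prefixParikh_cons {M : Type*} [AddMonoid M] (G : (X → ℕ) →+ M) (x a : X) (u : List X) :
    (prefixParikh x (a :: u)).map G = (if a = x then [0] else []) ++
      ((prefixParikh x u).map G).map (G (Pi.single a 1) + ·) := by
  rw [prefixParikh, List.map_append, List.map_map, List.map_map]
  congr 1
  · split_ifs <;> simp
  · exact congrArg (List.map · _) (funext fun v => map_add G _ _)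

/-- Reading off the exponent `0` recovers the first letter of a word, and the rest follows by
cancellation. -/
lemma eq_of_map_prefixParikh_perm {M : Type*} [AddCancelCommMonoid M] [Subsingleton (AddUnits M)]
    {G : (X → ℕ) →+ M} (hG : ∀ a b, G (Pi.single a 1) = 0 → G (Pi.single b 1) = 0 → a = b)
    {u v : List X} (h : ∀ x, ((prefixParikh x u).map G).Perm ((prefixParikh x v).map G)) :
    u = v := by
  have zero_mem (a : X) (u : List X) : 0 ∈ (prefixParikh a (a :: u)).map G := by
    simp [map_prefixParikh_cons]
  have single_eq_zero {a b : X} {u : List X} (hab : b ≠ a)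
      (h : 0 ∈ (prefixParikh a (b :: u)).map G) : G (Pi.single b 1) = 0 := by
    rw [map_prefixParikh_cons, if_neg hab, List.nil_append] at h
    obtain ⟨m, -, hm⟩ := List.mem_map.1 h
    exact (add_eq_zero.1 hm).1
  induction u generalizing v with
  | nil =>
    obtain _ | ⟨b, v⟩ := v
    · rfl
    · simpa [prefixParikh] using (h b).mem_iff.2 (zero_mem b v)
  | cons a u ih =>
    obtain _ | ⟨b, v⟩ := v
    · simpa [prefixParikh] using (h a).mem_iff.1 (zero_mem a u)
    have hab : a = b := by
      by_contra hab
      exact hab (hG a b (single_eq_zero hab ((h b).mem_iff.2 (zero_mem b v)))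
        (single_eq_zero (Ne.symm hab) ((h a).mem_iff.1 (zero_mem a u))))
    subst hab
    rw [ih fun x => ?_]
    have hx := h x
    rw [map_prefixParikh_cons, map_prefixParikh_cons, List.perm_append_left_iff,
      List.map_perm_map_iff (add_right_injective _)] at hx
    exact hx

theorem eq_of_mapDomain_fox_eq {M : Type*} [AddCancelCommMonoid M] [Subsingleton (AddUnits M)]
    {G : (X → ℕ) →+ M} (hG : ∀ a b, G (Pi.single a 1) = 0 → G (Pi.single b 1) = 0 → a = b)
    {u v : FreeMonoid X} (h : ∀ x, mapDomain G (fox x u) = mapDomain G (fox x v)) : u = v :=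
  toList.injective <| eq_of_map_prefixParikh_perm hG fun x => by
    simpa only [fox, mapDomain_monomialSum, monomialSum_inj] using h x

end Fox

section Solutions

open AddMonoidAlgebra FreeMonoid
open scoped Matrix

variable {X Y : Type*} [DecidableEq X] [DecidableEq Y]

/-- The vector of the differences of the Fox derivatives of the two sides of an equation. -/
noncomputable def Equation.foxDiff (E : Equation X) (x : X) : AddMonoidAlgebra ℤ (X → ℕ) :=
  fox x E.lhs - fox x E.rhs

lemma mem_sol_iff_dotProduct_fox_eq_zero [Fintype X] {g : FreeMonoid X →* FreeMonoid Y}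
    {E : Equation X} : g ∈ E.sol Y ↔ ∀ c,
      (mapDomainRingHom ℤ (parikhHom g) ∘ E.foxDiff) ⬝ᵥ (fun x => fox c (g (of x))) = 0 := by
  have dotProduct_eq (c : Y) :
      (mapDomainRingHom ℤ (parikhHom g) ∘ E.foxDiff) ⬝ᵥ (fun x => fox c (g (of x))) =
        fox c (g E.lhs) - fox c (g E.rhs) := by
    simp only [dotProduct, Function.comp_apply, Equation.foxDiff, map_sub, sub_mul,
      Finset.sum_sub_distrib, ← fox_map]
  simp only [dotProduct_eq, sub_eq_zero]
  refine ⟨fun h c => congrArg (fox c) h, fun h => ?_⟩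
  refine eq_of_mapDomain_fox_eq (G := AddMonoidHom.id _) (fun a b ha => ?_) fun c => ?_
  · simp at ha
  · rw [h c]

variable {g g' : FreeMonoid (Fin 3) →* FreeMonoid (Fin 2)} {E F : Equation (Fin 3)}

lemma fox_cross_fox_ne_zero (hg : parikhMatrix ℤ g 0 ⨯₃ parikhMatrix ℤ g 1 ≠ 0) :
    (fun x => fox 0 (g (of x))) ⨯₃ (fun x => fox 1 (g (of x))) ≠ 0 := by
  have augment (c : Fin 2) : (AddMonoidAlgebra.lift ℤ ℤ (Fin 2 → ℕ) 1).toRingHom ∘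
      (fun x => fox c (g (of x))) = parikhMatrix ℤ g c :=
    funext fun x => lift_fox c (g (of x))
  intro h
  apply hg
  rw [← augment, ← augment, ← map_comp_cross, h]
  exact funext fun _ => map_zero _

lemma foxDiff_ne_zero (hg : parikhMatrix ℤ g 0 ⨯₃ parikhMatrix ℤ g 1 ≠ 0) (hE : ¬ E.IsTrivial) :
    mapDomainRingHom ℤ (parikhHom g) ∘ E.foxDiff ≠ 0 := by
  contrapose! hE
  refine eq_of_mapDomain_fox_eq (G := parikhHom g) (fun a b ha hb => ?_) fun x => ?_
  · have dotProduct_eq_zero {a : Fin 3} (ha : parikhHom g (Pi.single a 1) = 0) (c : Fin 2) :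
        Pi.single a 1 ⬝ᵥ parikhMatrix ℤ g c = 0 := by
      rw [parikhHom_single] at ha
      simpa [parikhMatrix, parikh] using congrFun ha c
    have := cross_eq_zero_iff.1 (cross_eq_zero_of_dotProduct_eq_zero hg (dotProduct_eq_zero ha 0)
      (dotProduct_eq_zero ha 1) (dotProduct_eq_zero hb 0) (dotProduct_eq_zero hb 1)) a b
    by_contra hab
    simp [hab] at this
  · have hx := congrFun hE x
    rwa [Function.comp_apply, Equation.foxDiff, map_sub, Pi.zero_apply, sub_eq_zero] at hx

theorem mem_sol_iff_cross_foxDiff_eq_zero (hg : parikhMatrix ℤ g 0 ⨯₃ parikhMatrix ℤ g 1 ≠ 0)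
    (hE : ¬ E.IsTrivial) (hgE : g ∈ E.sol (Fin 2)) :
    g ∈ F.sol (Fin 2) ↔
      mapDomainRingHom ℤ (parikhHom g) ∘ (E.foxDiff ⨯₃ F.foxDiff) = 0 := by
  have hgE' := mem_sol_iff_dotProduct_fox_eq_zero.1 hgE
  rw [map_comp_cross, mem_sol_iff_dotProduct_fox_eq_zero]
  refine ⟨fun hgF => ?_, fun h c => ?_⟩
  · exact cross_eq_zero_of_dotProduct_eq_zero (fox_cross_fox_ne_zero hg)
      (hgE' 0) (hgE' 1) (hgF 0) (hgF 1)
  · exact dotProduct_eq_zero_of_cross_eq_zero (foxDiff_ne_zero hg hE) h (hgE' c)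

omit [DecidableEq X] [DecidableEq Y] in
lemma mapDomain_eq_zero_of_factorsThrough {R M N N' : Type*} [Semiring R] [Nonempty N']
    {G : M → N} {G' : M → N'} (hG : G'.FactorsThrough G) {f : AddMonoidAlgebra R M}
    (hf : mapDomain G f = 0) : mapDomain G' f = 0 := by
  obtain ⟨k, rfl⟩ := (Function.factorsThrough_iff G').1 hG
  have mapDomain_comp : mapDomain (k ∘ G) f = mapDomain k (mapDomain G f) := by
    ext
    simp [Finsupp.mapDomain_comp]
  rw [mapDomain_comp, hf, mapDomain_zero]

lemma mem_sol_of_common_kernel (hg : parikhMatrix ℤ g 0 ⨯₃ parikhMatrix ℤ g 1 ≠ 0)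
    (hg' : parikhMatrix ℤ g' 0 ⨯₃ parikhMatrix ℤ g' 1 ≠ 0) {d : Fin 3 → ℤ} (hd : d ≠ 0)
    (hgd : parikhMatrix ℤ g *ᵥ d = 0) (hgd' : parikhMatrix ℤ g' *ᵥ d = 0)
    (hE : ¬ E.IsTrivial) (hgE : g ∈ E.sol (Fin 2)) (hgE' : g' ∈ E.sol (Fin 2))
    (hgF : g ∈ F.sol (Fin 2)) : g' ∈ F.sol (Fin 2) := by
  rw [mem_sol_iff_cross_foxDiff_eq_zero hg hE hgE] at hgF
  rw [mem_sol_iff_cross_foxDiff_eq_zero hg' hE hgE']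
  have hfac : Function.FactorsThrough (parikhHom g') (parikhHom g) := fun u v huv => by
    rw [parikhHom_eq_parikhHom_iff] at huv ⊢
    exact mulVec_eq_zero_of_common_kernel hg hd hgd hgd' huv
  ext1 x
  exact mapDomain_eq_zero_of_factorsThrough hfac (congrFun hgF x)

theorem ker_eq_of_common_kernel (hg : parikhMatrix ℤ g 0 ⨯₃ parikhMatrix ℤ g 1 ≠ 0)
    (hg' : parikhMatrix ℤ g' 0 ⨯₃ parikhMatrix ℤ g' 1 ≠ 0) {d : Fin 3 → ℤ} (hd : d ≠ 0)
    (hgd : parikhMatrix ℤ g *ᵥ d = 0) (hgd' : parikhMatrix ℤ g' *ᵥ d = 0)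
    (hE : ¬ E.IsTrivial) (hgE : g ∈ E.sol (Fin 2)) (hgE' : g' ∈ E.sol (Fin 2)) :
    Con.ker g = Con.ker g' :=
  Con.ext fun u v =>
    ⟨mem_sol_of_common_kernel (F := ⟨u, v⟩) hg hg' hd hgd hgd' hE hgE hgE',
      mem_sol_of_common_kernel (F := ⟨u, v⟩) hg' hg hd hgd' hgd hE hgE' hgE⟩

end Solutions

section Cover

open AddMonoidAlgebra

variable {M N : Type*}

lemma exists_le_of_pairwise [Preorder M] [Nonempty M] {l : List M} (hl : l.Pairwise (· ≤ ·))
    (p : M → Prop) : ∃ m, ∀ a ∈ l, p a → p m ∧ m ≤ a := by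
  induction l with
  | nil => simp
  | cons b l ih =>
    rw [List.pairwise_cons] at hl
    simp only [List.forall_mem_cons]
    by_cases hb : p b
    · exact ⟨b, fun _ => ⟨hb, le_rfl⟩, fun a ha _ => ⟨hb, hl.1 a ha⟩⟩
    · obtain ⟨m, hm⟩ := ih hl.2
      exact ⟨m, fun h => absurd h hb, hm⟩

lemma exists_pos_neg_of_mapDomain_eq_zero [PartialOrder N] {f : AddMonoidAlgebra ℤ M} (hf : f ≠ 0)
    {G : M → N} (hG : mapDomain G f = 0) :
    ∃ a b, 0 < f.coeff a ∧ f.coeff b < 0 ∧ G a = G b ∧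
      ∀ m, f.coeff m ≠ 0 → G m ≤ G a → G m = G a := by
  classical
  have hs : f.coeff.support.Nonempty := by simpa [Finsupp.support_nonempty_iff] using hf
  obtain ⟨m, hm, hmin⟩ := f.coeff.support.finite_toSet.exists_minimalFor G _ hs
  have fiber_sum : ∑ a ∈ f.coeff.support with G a = G m, f.coeff a = 0 :=
    (Finsupp.mapDomain_apply_eq_sum G f.coeff).symm.trans
      (DFunLike.congr_fun (congrArg coeff hG) (G m))
  have hne : ∃ a ∈ f.coeff.support.filter (G · = G m), f.coeff a ≠ 0 :=
    ⟨m, Finset.mem_filter.2 ⟨hm, rfl⟩, Finsupp.mem_support_iff.1 hm⟩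
  obtain ⟨a, ha, hpos⟩ := Finset.exists_pos_of_sum_zero_of_exists_nonzero _ fiber_sum hne
  obtain ⟨b, hb, hneg⟩ := Finset.exists_pos_of_sum_zero_of_exists_nonzero (fun a => -f.coeff a)
    (by rw [Finset.sum_neg_distrib, fiber_sum, neg_zero]) (by simpa only [neg_ne_zero] using hne)
  have hGa := (Finset.mem_filter.1 ha).2
  have hGb := (Finset.mem_filter.1 hb).2
  refine ⟨a, b, hpos, neg_pos.1 hneg, hGa.trans hGb.symm, fun c hc hle => ?_⟩
  rw [hGa] at hle ⊢
  exact hle.antisymm (hmin (Finsupp.mem_support_iff.2 hc) hle)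

lemma exists_mem_of_coeff_monomialSum_flatten_lt {P Q : List (List M)} {m : M}
    (h : (monomialSum Q.flatten).coeff m < (monomialSum P.flatten).coeff m) :
    ∃ i, m ∈ P.get i := by
  classical
  rw [coeff_monomialSum, coeff_monomialSum, Nat.cast_lt] at h
  obtain ⟨l, hl, hml⟩ := List.mem_flatten.1 (List.count_pos_iff.1 (Nat.zero_lt_of_lt h))
  obtain ⟨i, rfl⟩ := List.get_of_mem hl
  exact ⟨i, hml⟩

/-- Choose in each chain the least monomial that does not cancel. A map annihilating `f` must
identify a positive and a negative monomial with minimal image, and by monotonicity these may be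
replaced by the chosen ones of their chains. -/
theorem exists_monomials_identified [PartialOrder M] [Nonempty M] [PartialOrder N]
    {P Q : List (List M)} (hP : ∀ l ∈ P, l.Pairwise (· ≤ ·)) (hQ : ∀ l ∈ Q, l.Pairwise (· ≤ ·))
    {f : AddMonoidAlgebra ℤ M} (hf : f ≠ 0)
    (hfPQ : f = monomialSum P.flatten - monomialSum Q.flatten) :
    ∃ (p : Fin P.length → M) (q : Fin Q.length → M), ∀ G : M → N, Monotone G →
      mapDomain G f = 0 → ∃ i j, p i ≠ q j ∧ G (p i) = G (q j) := by
  choose p hp using fun i : Fin P.length =>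
    exists_le_of_pairwise (hP _ (P.get_mem i)) fun m => 0 < f.coeff m
  choose q hq using fun i : Fin Q.length =>
    exists_le_of_pairwise (hQ _ (Q.get_mem i)) fun m => f.coeff m < 0
  refine ⟨p, q, fun G hG hGf => ?_⟩
  obtain ⟨a, b, ha, hb, hab, hmin⟩ := exists_pos_neg_of_mapDomain_eq_zero hf hGf
  obtain ⟨i, hi⟩ : ∃ i, a ∈ P.get i :=
    exists_mem_of_coeff_monomialSum_flatten_lt (Q := Q) (by simpa [hfPQ] using ha)
  obtain ⟨j, hj⟩ : ∃ j, b ∈ Q.get j :=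
    exists_mem_of_coeff_monomialSum_flatten_lt (Q := P) (by simpa [hfPQ] using hb)
  obtain ⟨hpi, hia⟩ := hp i a hi ha
  obtain ⟨hqj, hjb⟩ := hq j b hj hb
  refine ⟨i, j, fun h => (h ▸ hpi).not_gt hqj, ?_⟩
  rw [hmin _ hpi.ne' (hG hia), hmin _ hqj.ne (hab ▸ hG hjb)]

end Cover

section Minors

open AddMonoidAlgebra FreeMonoid

/-- The translates of a list by the entries of another one. -/
def translates {M : Type*} [Add M] (l l' : List M) : List (List M) :=
  l.map fun m => l'.map (m + ·)

lemma monomialSum_flatten_translates {M : Type*} [AddMonoid M] (l l' : List M) :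
    monomialSum (translates l l').flatten = monomialSum l * monomialSum l' := by
  induction l with
  | nil => simp [translates]
  | cons m l ih =>
    rw [translates] at ih ⊢
    rw [List.map_cons, List.flatten_cons, monomialSum_append, monomialSum_map_add, ih,
      monomialSum_cons, add_mul]

variable {X : Type*} [DecidableEq X]

lemma pairwise_of_mem_translates {l : List (X → ℕ)} {x : X} {u : List X} {c : List (X → ℕ)}
    (hc : c ∈ translates l (prefixParikh x u)) : c.Pairwise (· ≤ ·) := by
  obtain ⟨m, -, rfl⟩ := List.mem_map.1 hc
  exact (pairwise_prefixParikh x u).map _ fun _ _ h => add_le_add_right h m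

/-- The chains of exponents occurring with a positive sign in the expansion of the minor
`E.foxDiff x * F.foxDiff y - E.foxDiff y * F.foxDiff x`. Those with a negative sign are obtained
by exchanging `x` and `y`. -/
def Equation.minorChains (E F : Equation X) (x y : X) : List (List (X → ℕ)) :=
  translates (prefixParikh x E.lhs.toList) (prefixParikh y F.lhs.toList) ++
  translates (prefixParikh x E.rhs.toList) (prefixParikh y F.rhs.toList) ++
  translates (prefixParikh y E.lhs.toList) (prefixParikh x F.rhs.toList) ++
  translates (prefixParikh y E.rhs.toList) (prefixParikh x F.lhs.toList)

namespace Equation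

variable (E F : Equation X) (x y : X)

lemma length_minorChains : (E.minorChains F x y).length = E.occ x + E.occ y := by
  simp only [minorChains, translates, List.length_append, List.length_map, length_prefixParikh,
    occ, toList_mul, List.count_append]
  omega

variable {E F x y} in
lemma pairwise_of_mem_minorChains {c : List (X → ℕ)} (hc : c ∈ E.minorChains F x y) :
    c.Pairwise (· ≤ ·) := by
  simp only [minorChains, List.mem_append] at hc
  obtain ((hc | hc) | hc) | hc := hc <;> exact pairwise_of_mem_translates hc

lemma foxDiff_minor_eq : E.foxDiff x * F.foxDiff y - E.foxDiff y * F.foxDiff x =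
    monomialSum (E.minorChains F x y).flatten - monomialSum (E.minorChains F y x).flatten := by
  simp only [foxDiff, fox, minorChains, List.flatten_append, monomialSum_append,
    monomialSum_flatten_translates]
  ring

end Equation

end Minors

section Nonperiodic

open AddMonoidAlgebra FreeMonoid
open scoped Matrix

variable {A : Type*}

lemma parikhHom_monotone {X Y : Type*} [DecidableEq Y] [Fintype X]
    (g : FreeMonoid X →* FreeMonoid Y) : Monotone (parikhHom g) := fun u v huv => by
  obtain ⟨w, rfl⟩ := exists_add_of_le huv
  rw [map_add]
  exact le_self_add

lemma mem_sol_iff_of_ker_eq {X B : Type*} {h : FreeMonoid X →* FreeMonoid A}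
    {g : FreeMonoid X →* FreeMonoid B} (hgh : Con.ker g = Con.ker h) (E : Equation X) :
    g ∈ E.sol B ↔ h ∈ E.sol A :=
  Con.ext_iff.1 hgh E.lhs E.rhs

lemma exists_ker_eq_of_mem_sol {h : FreeMonoid (Fin 3) →* FreeMonoid A} {E : Equation (Fin 3)}
    (hper : ¬ IsPeriodic h) (hE : ¬ E.IsTrivial) (hhE : h ∈ E.sol A) :
    ∃ g : FreeMonoid (Fin 3) →* FreeMonoid (Fin 2), Con.ker g = Con.ker h ∧
      parikhMatrix ℤ g 0 ⨯₃ parikhMatrix ℤ g 1 ≠ 0 ∧ g ∈ E.sol (Fin 2) := by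
  obtain ⟨g, hgh, hsurj⟩ := exists_ker_eq_of_not_isPeriodic hper fun hinj => hE (hinj hhE)
  exact ⟨g, hgh, cross_ne_zero_of_mulVec_surjective hsurj, (mem_sol_iff_of_ker_eq hgh E).2 hhE⟩

lemma mapDomain_minor_eq_zero {g : FreeMonoid (Fin 3) →* FreeMonoid (Fin 2)}
    {E F : Equation (Fin 3)} (hg : parikhMatrix ℤ g 0 ⨯₃ parikhMatrix ℤ g 1 ≠ 0)
    (hE : ¬ E.IsTrivial) (hgE : g ∈ E.sol (Fin 2)) (hgF : g ∈ F.sol (Fin 2)) (x y : Fin 3) :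
    mapDomain (parikhHom g) (E.foxDiff x * F.foxDiff y - E.foxDiff y * F.foxDiff x) = 0 := by
  have h := (mem_sol_iff_cross_foxDiff_eq_zero hg hE hgE).1 hgF
  rw [map_comp_cross, cross_eq_zero_iff] at h
  rw [← mapDomainRingHom_apply, map_sub, map_mul, map_mul, sub_eq_zero]
  exact h x y

lemma exists_minor_ne_zero {h : FreeMonoid (Fin 3) →* FreeMonoid A} {E F : Equation (Fin 3)}
    (hper : ¬ IsPeriodic h) (hE : ¬ E.IsTrivial) (hhE : h ∈ E.sol A) (hhF : h ∉ F.sol A) :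
    ∃ x y, x ≠ y ∧ E.foxDiff x * F.foxDiff y - E.foxDiff y * F.foxDiff x ≠ 0 := by
  obtain ⟨g, hgh, hg, hgE⟩ := exists_ker_eq_of_mem_sol hper hE hhE
  rw [← mem_sol_iff_of_ker_eq hgh, mem_sol_iff_cross_foxDiff_eq_zero hg hE hgE] at hhF
  have hcross : E.foxDiff ⨯₃ F.foxDiff ≠ 0 := fun h => hhF (by rw [h]; ext1; exact map_zero _)
  simp only [Ne, cross_eq_zero_iff, not_forall] at hcross
  obtain ⟨x, y, hxy⟩ := hcross
  refine ⟨x, y, ?_, fun h => hxy ?_⟩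
  · rintro rfl
    exact hxy rfl
  · rw [sub_eq_zero.1 h]

theorem exists_encard_image_ker_le {h : FreeMonoid (Fin 3) →* FreeMonoid A}
    {E F : Equation (Fin 3)} (hper : ¬ IsPeriodic h) (hE : ¬ E.IsTrivial)
    (hhE : h ∈ E.sol A) (hhF : h ∉ F.sol A) :
    ∃ x y, x ≠ y ∧ (Con.ker '' {h | ¬ IsPeriodic h ∧ h ∈ E.sol A ∧ h ∈ F.sol A}).encard ≤
      (E.occ x + E.occ y) ^ 2 := by
  obtain ⟨x, y, hxy, hminor⟩ := exists_minor_ne_zero hper hE hhE hhF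
  obtain ⟨p, q, hpq⟩ := exists_monomials_identified (N := Fin 2 → ℕ)
    (fun _ => Equation.pairwise_of_mem_minorChains) (fun _ => Equation.pairwise_of_mem_minorChains)
    hminor (E.foxDiff_minor_eq F x y)
  refine ⟨x, y, hxy, ?_⟩
  have exists_data (c : Con.ker '' {h | ¬ IsPeriodic h ∧ h ∈ E.sol A ∧ h ∈ F.sol A}) :
      ∃ (g : FreeMonoid (Fin 3) →* FreeMonoid (Fin 2)) (ij : _ × _), Con.ker g = c ∧
        parikhMatrix ℤ g 0 ⨯₃ parikhMatrix ℤ g 1 ≠ 0 ∧ g ∈ E.sol (Fin 2) ∧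
        (fun z => (p ij.1 z : ℤ) - q ij.2 z) ≠ 0 ∧
        parikhMatrix ℤ g *ᵥ (fun z => (p ij.1 z : ℤ) - q ij.2 z) = 0 := by
    obtain ⟨-, k, ⟨hk, hkE, hkF⟩, rfl⟩ := c
    obtain ⟨g, hgk, hg, hgE⟩ := exists_ker_eq_of_mem_sol hk hE hkE
    obtain ⟨i, j, hij, heq⟩ := hpq _ (parikhHom_monotone g)
      (mapDomain_minor_eq_zero hg hE hgE ((mem_sol_iff_of_ker_eq hgk F).2 hkF) x y)
    refine ⟨g, (i, j), hgk, hg, hgE, fun h => hij ?_, (parikhHom_eq_parikhHom_iff g _ _).1 heq⟩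
    exact funext fun z => Nat.cast_injective (sub_eq_zero.1 (congrFun h z))
  choose g ij hgc hg hgE hne hker using exists_data
  have ij_injective : Function.Injective ij := fun c c' hcc => by
    rw [Subtype.ext_iff, ← hgc, ← hgc]
    exact ker_eq_of_common_kernel (hg c) (hg c') (hne c) (hker c) (hcc ▸ hker c') hE (hgE c)
      (hgE c')
  simpa [Equation.length_minorChains, add_comm, sq] using
    ENat.card_le_card_of_injective ij_injective

end Nonperiodic

section Periodic

open FreeMonoid
open scoped Matrix

variable {X A : Type*}

lemma IsPeriodic.exists_forall_mem_powers {h : FreeMonoid X →* FreeMonoid A} (hh : IsPeriodic h) :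
    ∃ t, ∀ u, h u ∈ Submonoid.powers t := by
  have hlt : rank h < 2 := hh.trans_lt (by norm_num)
  simp only [rank, iInf_lt_iff] at hlt
  obtain ⟨S, hS, hcard⟩ := hlt
  have hsub : S.Subsingleton :=
    Set.encard_le_one_iff_subsingleton.1 (Order.le_of_lt_add_one (by rwa [one_add_one_eq_two]))
  obtain ⟨t, ht⟩ : ∃ t, S ⊆ {t} := hsub.eq_empty_or_singleton.elim
    (fun hS => ⟨1, hS ▸ Set.empty_subset _⟩) fun ⟨t, hS⟩ => ⟨t, hS.subset⟩
  refine ⟨t, fun u => ?_⟩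
  rw [Submonoid.powers_eq_closure]
  induction u using FreeMonoid.inductionOn with
  | one => simp
  | of x => exact Submonoid.closure_mono ht (hS x)
  | mul u v hu hv => exact h.map_mul u v ▸ mul_mem hu hv

lemma IsPeriodic.map_eq_map_iff {h : FreeMonoid X →* FreeMonoid A} (hh : IsPeriodic h)
    {u v : FreeMonoid X} : h u = h v ↔ (h u).length = (h v).length := by
  have length_pow (t : FreeMonoid A) (n : ℕ) : (t ^ n).length = n * t.length := by
    induction n with
    | zero => simp
    | succ n ih => rw [pow_succ, length_mul, ih, add_one_mul]
  obtain ⟨t, ht⟩ := hh.exists_forall_mem_powers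
  obtain ⟨i, hi⟩ := ht u
  obtain ⟨j, hj⟩ := ht v
  refine ⟨congrArg length, fun hlen => ?_⟩
  rw [← hi, ← hj] at hlen ⊢
  simp only [length_pow, mul_eq_mul_right_iff, length_eq_zero] at hlen
  obtain rfl | rfl := hlen
  · rfl
  · simp

variable [DecidableEq X]

/-- The difference of the Parikh vectors of the two sides of an equation. -/
def Equation.balance (E : Equation X) : X → ℤ :=
  parikh ℤ E.lhs - parikh ℤ E.rhs

lemma cast_length_map [Fintype X] (h : FreeMonoid X →* FreeMonoid A) (u : FreeMonoid X) :
    ((h u).length : ℤ) = parikh ℤ u ⬝ᵥ fun x => ((h (of x)).length : ℤ) := by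
  induction u using FreeMonoid.inductionOn' with
  | one => simp
  | of_mul a u ih => simp [parikh_mul, parikh_of, ih, add_dotProduct]

lemma IsPeriodic.mem_sol_iff [Fintype X] {h : FreeMonoid X →* FreeMonoid A} (hh : IsPeriodic h)
    {E : Equation X} : h ∈ E.sol A ↔ E.balance ⬝ᵥ (fun x => ((h (of x)).length : ℤ)) = 0 := by
  rw [Equation.balance, sub_dotProduct, ← cast_length_map, ← cast_length_map, sub_eq_zero,
    Nat.cast_inj]
  exact hh.map_eq_map_iff

lemma parikhMatrix_mulVec_balance [Fintype X] {Y : Type*} [DecidableEq Y]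
    {g : FreeMonoid X →* FreeMonoid Y} {E : Equation X} (hg : g ∈ E.sol Y) :
    parikhMatrix ℤ g *ᵥ E.balance = 0 := by
  have : g E.lhs = g E.rhs := hg
  rw [Equation.balance, Matrix.mulVec_sub, ← parikh_map, ← parikh_map, this, sub_self]

end Periodic

section Triangular

open scoped Matrix

variable {R X κ : Type*} [CommRing R] [IsDomain R] [Fintype X] [LinearOrder κ]

lemma linearIndependent_of_dotProduct_triangular {d a : κ → X → R}
    (hlt : ∀ i j, i < j → d i ⬝ᵥ a j = 0) (hne : ∀ i, d i ⬝ᵥ a i ≠ 0) :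
    LinearIndependent R d := by
  rw [linearIndependent_iff]
  intro c hc
  by_contra hc0
  obtain ⟨i, hi, hmax⟩ := c.support.exists_max_image id (Finsupp.support_nonempty_iff.2 hc0)
  have hsum : ∑ j ∈ c.support, c j * (d j ⬝ᵥ a i) = 0 := by
    have := congrArg (· ⬝ᵥ a i) hc
    simpa [Finsupp.linearCombination_apply, Finsupp.sum, sum_dotProduct] using this
  rw [Finset.sum_eq_single_of_mem i hi fun j hj hji => by
    rw [hlt j i ((hmax j hj).lt_of_ne hji), mul_zero]] at hsum
  exact mul_ne_zero (Finsupp.mem_support_iff.1 hi) (hne i) hsum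

lemma card_le_of_dotProduct_triangular {d a : κ → X → R}
    (hlt : ∀ i j, i < j → d i ⬝ᵥ a j = 0) (hne : ∀ i, d i ⬝ᵥ a i ≠ 0) :
    ENat.card κ ≤ Fintype.card X := by
  have hd := (linearIndependent_of_dotProduct_triangular hlt hne).cardinalMk_le_finrank
  rw [Module.finrank_fintype_fun_eq_card] at hd
  exact Cardinal.toENat_le_natCast.2 hd

end Triangular

lemma card_le_encard_add_one_of_injOn_compl {ι α : Type*} {f : ι → α} {i : ι} {s : Set α}
    (hf : Set.InjOn f {i}ᶜ) (hs : Set.MapsTo f {i}ᶜ s) : ENat.card ι ≤ s.encard + 1 := by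
  rw [← Set.encard_univ, ← Set.encard_sdiff_singleton_add_one (Set.mem_univ i),
    ← Set.compl_eq_univ_sdiff]
  gcongr
  exact Set.encard_le_encard_of_injOn hs hf

section Independent

open scoped Matrix

variable {A ι : Type*}

lemma IsIndependent.exists_mem_sol_iff {X : Type*} {E : ι → Equation X} (hE : IsIndependent A E)
    (k : ι) : ∃ h : FreeMonoid X →* FreeMonoid A, ∀ i, h ∈ (E i).sol A ↔ i ≠ k := by
  have hsub : sysSol A E Set.univ ⊆ sysSol A E {k}ᶜ := fun h hh i _ => hh i trivial
  have hssub : ({k}ᶜ : Set ι) ⊂ Set.univ := Set.ssubset_univ_iff.2 (by simp)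
  obtain ⟨h, hh, hnot⟩ := Set.exists_of_ssubset (hsub.ssubset_of_ne (hE _ hssub).symm)
  refine ⟨h, fun i => ⟨?_, hh i⟩⟩
  rintro hi rfl
  refine hnot fun j _ => ?_
  obtain rfl | hj := eq_or_ne j i
  exacts [hi, hh j hj]

lemma Equation.balance_eq_zero {E F : Equation (Fin 3)} {h f : FreeMonoid (Fin 3) →* FreeMonoid A}
    (hh : ¬ IsPeriodic h) (hhE : h ∈ E.sol A) (hhF : h ∈ F.sol A) (hfE : f ∈ E.sol A)
    (hfF : f ∉ F.sol A) : E.balance = 0 := by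
  by_contra hbal
  have hE : ¬ E.IsTrivial := fun htriv => hbal (by rw [balance, htriv, sub_self])
  obtain ⟨g, hgh, hg, hgE⟩ := exists_ker_eq_of_mem_sol hh hE hhE
  have hgF := (mem_sol_iff_of_ker_eq hgh F).2 hhF
  by_cases hf : IsPeriodic f
  · rw [hf.mem_sol_iff, dotProduct_comm] at hfE hfF
    exact hfF (congrFun (mulVec_eq_zero_of_common_kernel (M' := fun _ : Unit => _) hg hbal
      (parikhMatrix_mulVec_balance hgE) (funext fun _ => hfE)
      (parikhMatrix_mulVec_balance hgF)) ())
  · obtain ⟨g', hgf, hg', hgE'⟩ := exists_ker_eq_of_mem_sol hf hE hfE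
    rw [← mem_sol_iff_of_ker_eq hgf] at hfF
    exact hfF (mem_sol_of_common_kernel hg hg' hbal (parikhMatrix_mulVec_balance hgE)
      (parikhMatrix_mulVec_balance hgE') hE hgE hgE' hgF)

theorem IsIndependent.card_le {E : ι → Equation (Fin 3)} (hE : IsIndependent A E)
    {h : FreeMonoid (Fin 3) →* FreeMonoid A} (hh : ¬ IsPeriodic h)
    (hhE : h ∈ sysSol A E Set.univ) (i₀ : ι) :
    ∃ x y : Fin 3, x ≠ y ∧ ENat.card ι ≤ ((E i₀).occ x + (E i₀).occ y) ^ 2 + 1 := by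
  classical
  by_cases hι : Subsingleton ι
  · exact ⟨0, 1, by decide, (ENat.card_le_one_iff_subsingleton ι).2 hι |>.trans le_add_self⟩
  have : Nontrivial ι := not_subsingleton_iff_nontrivial.1 hι
  obtain ⟨k₀, hk₀⟩ := exists_ne i₀
  choose w hw using hE.exists_mem_sol_iff
  have balance_eq_zero (j : ι) : (E j).balance = 0 := by
    obtain ⟨i, hij⟩ := exists_ne j
    exact Equation.balance_eq_zero hh (hhE j trivial) (hhE i trivial) ((hw i j).2 hij.symm)
      fun hi => (hw i i).1 hi rfl
  have hwper (k : ι) : ¬ IsPeriodic (w k) := fun hk =>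
    (hw k k).1 (hk.mem_sol_iff.2 (by rw [balance_eq_zero, zero_dotProduct])) rfl
  have hnontriv : ¬ (E i₀).IsTrivial := fun htriv =>
    (hw i₀ i₀).1 (congrArg (w i₀) htriv) rfl
  obtain ⟨x, y, hxy, hcard⟩ := exists_encard_image_ker_le (F := E k₀) (hwper k₀) hnontriv
    ((hw k₀ i₀).2 hk₀.symm) fun hk => (hw k₀ k₀).1 hk rfl
  let v := Function.update w k₀ h
  have mem_sol_iff (k l : ι) : v k ∈ (E l).sol A ↔ (l = k → k = k₀) := by
    obtain rfl | hk := eq_or_ne k k₀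
    · simp [v, hhE l trivial]
    · simp [v, hk, hw]
  have hvper (k : ι) : ¬ IsPeriodic (v k) := by
    obtain rfl | hk := eq_or_ne k k₀
    · simpa [v] using hh
    · simpa [v, hk] using hwper k
  have ker_injective : Function.Injective fun k => Con.ker (v k) := fun k l hkl => by
    have hk := mem_sol_iff_of_ker_eq hkl (E k)
    have hl := mem_sol_iff_of_ker_eq hkl (E l)
    simp only [mem_sol_iff] at hk hl
    grind
  refine ⟨x, y, hxy, le_trans (card_le_encard_add_one_of_injOn_compl (i := i₀)
    ker_injective.injOn fun k hk => ?_) (add_le_add_left hcard 1)⟩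
  exact ⟨v k, ⟨hvper k, by grind, by grind⟩, rfl⟩

end Independent

section Chain

variable {A κ : Type*} [LinearOrder κ]

lemma card_le_of_isPeriodic {X : Type*} [Fintype X] {E : κ → Equation X}
    {w : κ → FreeMonoid X →* FreeMonoid A} (hlt : ∀ j k, j < k → w k ∈ (E j).sol A)
    (hne : ∀ k, w k ∉ (E k).sol A) (hw : ∀ k, IsPeriodic (w k)) :
    ENat.card κ ≤ Fintype.card X := by
  classical
  simp only [(hw _).mem_sol_iff] at hlt hne
  exact card_le_of_dotProduct_triangular hlt hne

lemma ker_injective {X : Type*} {E : κ → Equation X}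
    {w : κ → FreeMonoid X →* FreeMonoid A} (hlt : ∀ j k, j < k → w k ∈ (E j).sol A)
    (hne : ∀ k, w k ∉ (E k).sol A) : Function.Injective fun k => Con.ker (w k) := by
  refine .of_lt_imp_ne fun j k hjk heq => hne j ?_
  exact (mem_sol_iff_of_ker_eq heq (E j)).2 (hlt j k hjk)

lemma card_le_of_not_isPeriodic [WellFoundedLT κ] {E₀ : Equation (Fin 3)} (hE₀ : ¬ E₀.IsTrivial)
    {E : κ → Equation (Fin 3)} {w : κ → FreeMonoid (Fin 3) →* FreeMonoid A}
    (hlt : ∀ j k, j < k → w k ∈ (E j).sol A) (hne : ∀ k, w k ∉ (E k).sol A)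
    (hw : ∀ k, ¬ IsPeriodic (w k)) (hwE₀ : ∀ k, w k ∈ E₀.sol A) :
    ∃ x y : Fin 3, x ≠ y ∧ ENat.card κ ≤ (E₀.occ x + E₀.occ y) ^ 2 + 1 := by
  cases isEmpty_or_nonempty κ
  · exact ⟨0, 1, by decide, ((ENat.card_eq_zero_iff_empty κ).2 ‹_›).trans_le zero_le⟩
  let := WellFoundedLT.toOrderBot κ
  obtain ⟨x, y, hxy, hcard⟩ := exists_encard_image_ker_le (hw ⊥) hE₀ (hwE₀ ⊥) (hne ⊥)
  refine ⟨x, y, hxy, le_trans (card_le_encard_add_one_of_injOn_compl (i := ⊥)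
    (ker_injective hlt hne).injOn fun k hk => ?_) (add_le_add_left hcard 1)⟩
  exact ⟨w k, ⟨hw k, hwE₀ k, hlt ⊥ k (bot_lt_iff_ne_bot.2 hk)⟩, rfl⟩

lemma exists_mem_sol_of_sysSol_ne {X ι : Type*} [LinearOrder ι] {E : ι → Equation X} {k : ι}
    (hk : sysSol A E (Set.Iic k) ≠ sysSol A E (Set.Iio k)) :
    ∃ h, (∀ j < k, h ∈ (E j).sol A) ∧ h ∉ (E k).sol A := by
  have hsub : sysSol A E (Set.Iic k) ⊆ sysSol A E (Set.Iio k) := fun h hh j hj => hh j hj.le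
  obtain ⟨h, hh, hnot⟩ := Set.exists_of_ssubset (hsub.ssubset_of_ne hk)
  refine ⟨h, hh, fun hhk => hnot fun j hj => ?_⟩
  obtain rfl | hjk := eq_or_lt_of_le hj
  exacts [hhk, hh j hjk]

theorem card_le_of_sysSol_ne {ι : Type*} [LinearOrder ι] [WellFoundedLT ι]
    {E : ι → Equation (Fin 3)} {i₀ : ι} (hi₀ : IsBot i₀) (hE₀ : ¬ (E i₀).IsTrivial)
    (hE : ∀ k ≠ i₀, sysSol A E (Set.Iic k) ≠ sysSol A E (Set.Iio k)) :
    ∃ x y : Fin 3, x ≠ y ∧ ENat.card ι ≤ ((E i₀).occ x + (E i₀).occ y) ^ 2 + 5 := by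
  have exists_witness (k : ι) : ∃ h, k ≠ i₀ → (∀ j < k, h ∈ (E j).sol A) ∧ h ∉ (E k).sol A := by
    obtain rfl | hk := eq_or_ne k i₀
    · exact ⟨1, fun h => absurd rfl h⟩
    · exact (exists_mem_sol_of_sysSol_ne (hE k hk)).imp fun _ hh _ => hh
  choose w hw using exists_witness
  let B := {k | k ≠ i₀ ∧ IsPeriodic (w k)}
  let C := {k | k ≠ i₀ ∧ ¬ IsPeriodic (w k)}
  have hB : B.encard ≤ 3 := card_le_of_isPeriodic (E := fun k : B => E k) (w := fun k => w k)
    (fun j k hjk => (hw k k.2.1).1 j hjk) (fun k => (hw k k.2.1).2) fun k => k.2.2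
  obtain ⟨x, y, hxy, hC⟩ := card_le_of_not_isPeriodic hE₀ (E := fun k : C => E k)
    (w := fun k => w k) (fun j k hjk => (hw k k.2.1).1 j hjk) (fun k => (hw k k.2.1).2)
    (fun k => k.2.2) fun k => (hw k k.2.1).1 i₀ ((hi₀ k).lt_of_ne' k.2.1)
  refine ⟨x, y, hxy, ?_⟩
  have hcover : (Set.univ : Set ι) ⊆ {i₀} ∪ B ∪ C := fun k _ => by
    simp only [B, C, Set.mem_union, Set.mem_singleton_iff, Set.mem_ofPred_eq]
    tauto
  calc ENat.card ι = (Set.univ : Set ι).encard := (Set.encard_univ ι).symm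
    _ ≤ ({i₀} : Set ι).encard + B.encard + C.encard :=
      (Set.encard_le_encard hcover).trans ((Set.encard_union_le _ _).trans
        (add_le_add_left (Set.encard_union_le _ _) _))
    _ ≤ 1 + 3 + (((E i₀).occ x + (E i₀).occ y) ^ 2 + 1) := by
      gcongr
      · exact (Set.encard_singleton i₀).le
      · exact hC
    _ = ((E i₀).occ x + (E i₀).occ y) ^ 2 + 5 := by ring

lemma IsChain.sysSol_Iic_ne {X : Type*} {m : ℕ} {E : Fin m → Equation X} (hE : IsChain A E)
    {k : Fin m} (hk : ¬ IsMin k) : sysSol A E (Set.Iic k) ≠ sysSol A E (Set.Iio k) := by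
  rw [← Set.Iic_pred_eq_Iio_of_not_isMin hk]
  exact (hE.2 (Order.pred_lt_of_not_isMin hk)).ne

end Chain

end WordEq

theorem mainTheorem2_general {A ι : Type*} (E : ι → WordEq.Equation (Fin 3)) (i₀ : ι) :
    ((WordEq.IsIndependent A E ∧ ∃ h ∈ WordEq.sysSol A E Set.univ, ¬ WordEq.IsPeriodic h) →
      ∃ x y : Fin 3, x ≠ y ∧ ENat.card ι ≤ ((E i₀).occ x + (E i₀).occ y) ^ 2 + 1) ∧
    (∀ [LinearOrder ι] [WellFoundedLT ι], IsBot i₀ → ¬ (E i₀).IsTrivial →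
      (∀ k ≠ i₀, WordEq.sysSol A E (Set.Iic k) ≠ WordEq.sysSol A E (Set.Iio k)) →
      ∃ x y : Fin 3, x ≠ y ∧ ENat.card ι ≤ ((E i₀).occ x + (E i₀).occ y) ^ 2 + 5) := by
  refine ⟨?_, fun hi₀ => WordEq.card_le_of_sysSol_ne hi₀⟩
  rintro ⟨hE, h, hhE, hh⟩
  exact hE.card_le hh hhE i₀

theorem mainTheorem2 (A : Type*) (m : ℕ) (hm : 0 < m) (E : Fin m → WordEq.Equation (Fin 3)) :
    ((WordEq.IsIndependent A E ∧ ∃ h ∈ WordEq.sysSol A E Set.univ, ¬ WordEq.IsPeriodic h) →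
      ∃ x y : Fin 3, x ≠ y ∧ m ≤ ((E ⟨0, hm⟩).occ x + (E ⟨0, hm⟩).occ y) ^ 2 + 1) ∧
    (WordEq.IsChain A E →
      ∃ x y : Fin 3, x ≠ y ∧ m ≤ ((E ⟨0, hm⟩).occ x + (E ⟨0, hm⟩).occ y) ^ 2 + 5) := by
  have h0 : IsBot (⟨0, hm⟩ : Fin m) := fun k => Nat.zero_le k
  obtain ⟨hind, hchain⟩ := mainTheorem2_general (A := A) E ⟨0, hm⟩
  simp only [ENat.card_eq_coe_fintype_card, Fintype.card_fin] at hind hchain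
  norm_cast at hind hchain
  exact ⟨hind, fun hE => hchain h0 (hE.1 _) fun k hk => hE.sysSol_Iic_ne fun hmin => hk
    (hmin.eq_of_ge (h0 k))⟩
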